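/- Let $\mathbb K$ be $\mathbb R$ or $\mathbb C$ and let $\omega\subset\mathbb R^m$ be a bounded open set. Then the full Colombeau algebra $\mathcal G(\overline\omega)$, endowed with the topology $\mathcal T_{\overline\omega,b}$, is complete (with respect to the uniform structure of its additive topological group, every Cauchy filter, and in particular every Cauchy sequence, converges). Here the notation is as follows. *Test functions.* For $q\in\mathbb N$, $\mathcal A_q$ is the set of $\varphi\in\mathcal D(\mathbb R^m;\mathbb K)$ with $\int\varphi=1$ and $\int x^\alpha\varphi(x)\,dx=0$ for $1\le|\alpha|\le q$; $\varphi_\varepsilon(x)=\varepsilon^{-m}\varphi(x/\varepsilon)$ and $i(\varphi)=\operatorname{diam}\operatorname{supp}\varphi$. $\Gamma$ is the set of increasing functions $\gamma:\mathbb N\to[0,\infty)$ with $\gamma(q)\to\infty$. *Generalized real numbers.* A function $x:\mathcal A_0\to\mathbb R$ is moderate if there is $N\in\mathbb N$ such that for every $\varphi\in\mathcal A_N$ there are $c>0$ and $\eta\in\,]0,1]$ with $|x(\varphi_\varepsilon)|\le c\,\varepsilon^{-N}$ for $0<\varepsilon<\eta$. It is null if there are $N\in\mathbb N$ and $\gamma\in\Gamma$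 such that for every $q\ge N$ and every $\varphi\in\mathcal A_q$ there are $c>0$ and $\eta\in\,]0,1]$ with $|x(\varphi_\varepsilon)|\le c\,\varepsilon^{\gamma(q)-N}$ for $0<\varepsilon<\eta$. $\overline{\mathbb R}$ is the ring of moderate functions modulo the ideal of null functions. For $a,b\in\overline{\mathbb R}$, $a\le b$ means that $b-a$ has a representative that is nonnegative at every $\varphi\in\mathcal A_0$. For $r\in\mathbb R$, $\alpha_r^\bullet\in\overline{\mathbb R}$ is the class of $\varphi\mapsto i(\varphi)^r$. *The algebra.* $\mathcal C^\infty(\overline\omega;\mathbb K)$ is the algebra of continuous functions on $\overline\omega$ that are smooth in the interior of $\overline\omega$ and all of whose partial derivatives extend continuously to $\overline\omega$; $\partial^\sigma$ denotes these extensions and $\|\cdot\|$ the supremum norm on $\overline\omega$. For a map $u$ assigning to each $\varphi\in\mathcal A_0$ a function $u(\varphi,\cdot)\in\mathcal C^\infty(\overline\omega;\mathbb K)$ and for $\sigma\in\mathbb N^m$, put $u_\sigma(\varphi)=\|\partial^\sigma u(\varphi,\cdot)\|$. $\mathcal E_M[\overline\omega]$ is the algebra of those $u$ for which $u_\sigma$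 is moderate for every $\sigma$, $\mathcal N[\overline\omega]$ is the ideal of those for which $u_\sigma$ is null for every $\sigma$, and $\mathcal G(\overline\omega)=\mathcal E_M[\overline\omega]/\mathcal N[\overline\omega]$. *The topology.* For $f\in\mathcal G(\overline\omega)$ with representative $u$, $\|f\|_\sigma\in\overline{\mathbb R}$ is the class of $u_\sigma$, which does not depend on $u$. For $\sigma\in\mathbb N^m$ and $r\in\mathbb R$ let $$W_{\sigma,r}=\{f\in\mathcal G(\overline\omega):\ \|f\|_\kappa\le\alpha_r^\bullet\ \text{ for all }\kappa\le\sigma\}.$$ $\mathcal T_{\overline\omega,b}$ is the translation-invariant topology on $\mathcal G(\overline\omega)$ for which the sets $W_{\sigma,r}$, with $\sigma\in\mathbb N^m$ and $r\in\{1,2,3,\dots\}$, form a fundamental system of neighbourhoods of $0$. -/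

import Mathlib

open MeasureTheory Filter Topology

noncomputable section

namespace FullColombeau

/-- Euclidean space `ℝ^m`. -/
abbrev E (m : ℕ) : Type := EuclideanSpace ℝ (Fin m)

/-- A multi-index `σ ∈ ℕ^m`, with the componentwise order. -/
abbrev MultiIndex (m : ℕ) : Type := Fin m → ℕ

/-! ### Test functions -/

/-- The set `A_q = A_q(m; 𝕜)` of test functions `φ ∈ D(ℝ^m; 𝕜)` with `∫ φ = 1` and
`∫ x^α φ(x) dx = 0` for all multi-indices `α` with `1 ≤ |α| ≤ q`. -/
def testSet (m : ℕ) (𝕜 : Type*) [RCLike 𝕜] (q : ℕ) : Set (E m → 𝕜) :=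
  {φ | ContDiff ℝ (⊤ : ℕ∞) φ ∧ HasCompactSupport φ ∧ ∫ x, φ x = 1 ∧
    ∀ α : MultiIndex m, 1 ≤ ∑ i, α i → ∑ i, α i ≤ q → ∫ x, (∏ i, x i ^ α i) • φ x = 0}

/-- `A_0` as a type. -/
abbrev A0 (m : ℕ) (𝕜 : Type*) [RCLike 𝕜] : Type _ := ↥(testSet m 𝕜 0)

section Test

variable {m : ℕ} {𝕜 : Type*} [RCLike 𝕜]

theorem testSet_anti {p q : ℕ} (h : p ≤ q) : testSet m 𝕜 q ⊆ testSet m 𝕜 p :=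
  fun _ hφ => ⟨hφ.1, hφ.2.1, hφ.2.2.1, fun α h1 h2 => hφ.2.2.2 α h1 (h2.trans h)⟩

/-- The rescaled function `φ_ε(x) = ε^{-m} φ(x / ε)`. -/
def dilateFun (ε : ℝ) (φ : E m → 𝕜) : E m → 𝕜 := fun x => (ε ^ m)⁻¹ • φ (ε⁻¹ • x)

theorem dilateFun_mem {ε : ℝ} (hε : 0 < ε) {q : ℕ} {φ : E m → 𝕜} (hφ : φ ∈ testSet m 𝕜 q) :
    dilateFun ε φ ∈ testSet m 𝕜 q := by
  obtain ⟨h1, h2, h3, h4⟩ := hφ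
  refine ⟨?_, ?_, ?_, ?_⟩
  · exact (h1.comp (contDiff_id.const_smul ε⁻¹)).const_smul _
  · have h := h2.comp_smul (inv_ne_zero hε.ne')
    exact h.smul_left (f := fun _ => (ε ^ m)⁻¹)
  · have hm : ε ^ m ≠ 0 := pow_ne_zero _ hε.ne'
    simp only [dilateFun]
    rw [integral_smul, Measure.integral_comp_inv_smul_of_nonneg _ _ hε.le, h3]
    simp [smul_smul, hm]
  · intro α ha hb
    have key : ∀ x : E m, (∏ i, x i ^ α i) • dilateFun ε φ x =
        ((ε ^ m)⁻¹ * ε ^ ∑ i, α i) •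
          (fun y : E m => (∏ i, y i ^ α i) • φ y) (ε⁻¹ • x) := by
      intro x
      have : ∏ i, x i ^ α i = ε ^ (∑ i, α i) * ∏ i, (ε⁻¹ • x) i ^ α i := by
        rw [← Finset.prod_pow_eq_pow_sum, ← Finset.prod_mul_distrib]
        refine Finset.prod_congr rfl fun i _ => ?_
        rw [← mul_pow]
        simp [hε.ne']
      simp only [dilateFun, smul_smul]
      rw [this]
      congr 1
      ring
    simp_rw [key]
    have h5 := Measure.integral_comp_inv_smul_of_nonneg (volume : Measure (E m))
      (fun y : E m => (∏ i, y i ^ α i) • φ y) hε.le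
    rw [h4 α ha hb, smul_zero] at h5
    rw [integral_smul, h5, smul_zero]

/-- The rescaling `φ ↦ φ_ε`, `ε > 0`, as a map of `A_0` to itself. -/
def dilate (ε : ℝ) (hε : 0 < ε) (φ : A0 m 𝕜) : A0 m 𝕜 :=
  ⟨dilateFun ε φ.1, dilateFun_mem hε φ.2⟩

/-- `i(φ) = diam supp φ`. -/
def supportDiam (φ : A0 m 𝕜) : ℝ := Metric.diam (tsupport (φ : E m → 𝕜))

theorem supportDiam_dilate (ε : ℝ) (hε : 0 < ε) (φ : A0 m 𝕜) :
    supportDiam (dilate ε hε φ) = ε * supportDiam φ := by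
  have : Function.support (dilateFun ε (φ : E m → 𝕜)) =
      (fun x : E m => ε • x) '' Function.support (φ : E m → 𝕜) := by
    ext x
    simp only [Function.mem_support, dilateFun, Set.mem_image]
    constructor
    · intro h
      refine ⟨ε⁻¹ • x, fun h0 => h (by rw [h0, smul_zero]), by simp [smul_smul, hε.ne']⟩
    · rintro ⟨y, hy, rfl⟩
      simp [smul_smul, hε.ne', hy]
  simp only [supportDiam, dilate, tsupport, Metric.diam_closure]
  rw [this, Set.image_smul, diam_smul₀, Real.norm_of_nonneg hε.le]

theorem supportDiam_nonneg (φ : A0 m 𝕜) : 0 ≤ supportDiam φ := Metric.diam_nonneg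

/-! ### Moderate and null scalar nets, the ring of generalized real numbers -/

/-- `|x(φ_ε)| = O(ε^s)` as `ε → 0`: there are `c > 0` and `η ∈ ]0, 1]` with
`|x(φ_ε)| ≤ c ε^s` for all `ε ∈ ]0, η[`. -/
def BoundedBy (x : A0 m 𝕜 → ℝ) (φ : A0 m 𝕜) (s : ℝ) : Prop :=
  ∃ c : ℝ, 0 < c ∧ ∃ η : ℝ, 0 < η ∧ η ≤ 1 ∧
    ∀ (ε : ℝ) (hε : 0 < ε), ε < η → |x (dilate ε hε φ)| ≤ c * ε ^ s

/-- Moderate functions `x : A_0 → ℝ`. -/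
def IsModerate (x : A0 m 𝕜 → ℝ) : Prop :=
  ∃ N : ℕ, ∀ φ : A0 m 𝕜, (φ : E m → 𝕜) ∈ testSet m 𝕜 N → BoundedBy x φ (-(N : ℝ))

/-- The set `Γ` of the increasing functions `γ : ℕ → ℝ_+` which tend to infinity. -/
def Gam : Set (ℕ → ℝ) := {γ | Monotone γ ∧ (∀ q, 0 ≤ γ q) ∧ Tendsto γ atTop atTop}

/-- Null functions `x : A_0 → ℝ`. -/
def IsNull (x : A0 m 𝕜 → ℝ) : Prop :=
  ∃ N : ℕ, ∃ γ ∈ Gam, ∀ q : ℕ, N ≤ q → ∀ φ : A0 m 𝕜,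
    (φ : E m → 𝕜) ∈ testSet m 𝕜 q → BoundedBy x φ (γ q - N)

theorem BoundedBy.mono {x y : A0 m 𝕜 → ℝ} {φ : A0 m 𝕜} {s t : ℝ} (h : BoundedBy x φ s)
    (hxy : ∀ ψ, |y ψ| ≤ |x ψ|) (hts : t ≤ s) : BoundedBy y φ t := by
  obtain ⟨c, hc, η, h0, h1, h2⟩ := h
  refine ⟨c, hc, η, h0, h1, fun ε hε hη => (hxy _).trans ((h2 ε hε hη).trans ?_)⟩
  exact mul_le_mul_of_nonneg_left
    (Real.rpow_le_rpow_of_exponent_ge hε (hη.le.trans h1) hts) hc.le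

theorem BoundedBy.add {x y : A0 m 𝕜 → ℝ} {φ : A0 m 𝕜} {s : ℝ} (hx : BoundedBy x φ s)
    (hy : BoundedBy y φ s) : BoundedBy (x + y) φ s := by
  obtain ⟨c, hc, η, h0, h1, h2⟩ := hx
  obtain ⟨d, hd, θ, k0, k1, k2⟩ := hy
  refine ⟨c + d, by positivity, min η θ, lt_min h0 k0, (min_le_left _ _).trans h1, ?_⟩
  intro ε hε hlt
  have a := h2 ε hε (hlt.trans_le (min_le_left _ _))
  have b := k2 ε hε (hlt.trans_le (min_le_right _ _))
  calc |x (dilate ε hε φ) + y (dilate ε hε φ)| ≤ _ := abs_add_le _ _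
    _ ≤ _ := by rw [add_mul]; exact add_le_add a b

theorem BoundedBy.mul {x y : A0 m 𝕜 → ℝ} {φ : A0 m 𝕜} {s t : ℝ} (hx : BoundedBy x φ s)
    (hy : BoundedBy y φ t) : BoundedBy (x * y) φ (s + t) := by
  obtain ⟨c, hc, η, h0, h1, h2⟩ := hx
  obtain ⟨d, hd, θ, k0, k1, k2⟩ := hy
  refine ⟨c * d, by positivity, min η θ, lt_min h0 k0, (min_le_left _ _).trans h1, ?_⟩
  intro ε hε hlt
  have a := h2 ε hε (hlt.trans_le (min_le_left _ _))
  have b := k2 ε hε (hlt.trans_le (min_le_right _ _))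
  rw [Pi.mul_apply, abs_mul, Real.rpow_add hε]
  calc _ ≤ (c * ε ^ s) * (d * ε ^ t) := mul_le_mul a b (abs_nonneg _) (by positivity)
    _ = _ := by ring

theorem IsModerate.mono {x y : A0 m 𝕜 → ℝ} (hx : IsModerate x) (h : ∀ φ, |y φ| ≤ |x φ|) :
    IsModerate y := by
  obtain ⟨N, hN⟩ := hx
  exact ⟨N, fun φ hφ => (hN φ hφ).mono h le_rfl⟩

theorem IsModerate.add {x y : A0 m 𝕜 → ℝ} (hx : IsModerate x) (hy : IsModerate y) :
    IsModerate (x + y) := by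
  obtain ⟨N, hN⟩ := hx
  obtain ⟨M, hM⟩ := hy
  refine ⟨max N M, fun φ hφ => BoundedBy.add ?_ ?_⟩
  · exact (hN φ (testSet_anti (le_max_left _ _) hφ)).mono (fun _ => le_rfl)
      (neg_le_neg (by exact_mod_cast le_max_left N M))
  · exact (hM φ (testSet_anti (le_max_right _ _) hφ)).mono (fun _ => le_rfl)
      (neg_le_neg (by exact_mod_cast le_max_right N M))

theorem IsModerate.mul {x y : A0 m 𝕜 → ℝ} (hx : IsModerate x) (hy : IsModerate y) :
    IsModerate (x * y) := by
  obtain ⟨N, hN⟩ := hx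
  obtain ⟨M, hM⟩ := hy
  refine ⟨N + M, fun φ hφ => ?_⟩
  have := (hN φ (testSet_anti (by omega) hφ)).mul (hM φ (testSet_anti (by omega) hφ))
  exact this.mono (fun _ => le_rfl) (by push_cast; linarith)

theorem isModerate_const (c : ℝ) : IsModerate (fun _ : A0 m 𝕜 => c) :=
  ⟨0, fun φ _ => ⟨|c| + 1, by positivity, 1, one_pos, le_rfl, fun ε hε _ => by simp⟩⟩

theorem IsNull.mono {x y : A0 m 𝕜 → ℝ} (hx : IsNull x) (h : ∀ φ, |y φ| ≤ |x φ|) :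
    IsNull y := by
  obtain ⟨N, γ, hγ, hN⟩ := hx
  exact ⟨N, γ, hγ, fun q hq φ hφ => (hN q hq φ hφ).mono h le_rfl⟩

theorem IsNull.isModerate {x : A0 m 𝕜 → ℝ} (hx : IsNull x) : IsModerate x := by
  obtain ⟨N, γ, hγ, hN⟩ := hx
  exact ⟨N, fun φ hφ => (hN N le_rfl φ hφ).mono (fun _ => le_rfl) (by linarith [hγ.2.1 N])⟩

theorem IsNull.add {x y : A0 m 𝕜 → ℝ} (hx : IsNull x) (hy : IsNull y) : IsNull (x + y) := by
  obtain ⟨N, γ, hγ, hN⟩ := hx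
  obtain ⟨M, δ, hδ, hM⟩ := hy
  refine ⟨max N M, fun q => min (γ q) (δ q),
    ⟨fun a b h => min_le_min (hγ.1 h) (hδ.1 h), fun q => le_min (hγ.2.1 q) (hδ.2.1 q), ?_⟩,
    fun q hq φ hφ => BoundedBy.add ?_ ?_⟩
  · rw [tendsto_atTop]
    intro b
    filter_upwards [tendsto_atTop.1 hγ.2.2 b, tendsto_atTop.1 hδ.2.2 b] with q h1 h2
    exact le_min h1 h2
  · exact (hN q ((le_max_left _ _).trans hq) φ hφ).mono (fun _ => le_rfl)
      (sub_le_sub (min_le_left _ _) (by exact_mod_cast le_max_left N M))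
  · exact (hM q ((le_max_right _ _).trans hq) φ hφ).mono (fun _ => le_rfl)
      (sub_le_sub (min_le_right _ _) (by exact_mod_cast le_max_right N M))

theorem IsNull.mul {x y : A0 m 𝕜 → ℝ} (hx : IsNull x) (hy : IsModerate y) :
    IsNull (x * y) := by
  obtain ⟨N, γ, hγ, hN⟩ := hx
  obtain ⟨M, hM⟩ := hy
  refine ⟨N + M, γ, hγ, fun q hq φ hφ => ?_⟩
  have := (hN q (by omega) φ hφ).mul (hM φ (testSet_anti (by omega) hφ))
  exact this.mono (fun _ => le_rfl) (by push_cast; linarith)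

/-- A function which vanishes on `φ_ε` for all small `ε`, for every `φ` in some `A_N`,
is null. -/
theorem isNull_of_eventually_zero {x : A0 m 𝕜 → ℝ} (N : ℕ)
    (h : ∀ φ : A0 m 𝕜, (φ : E m → 𝕜) ∈ testSet m 𝕜 N →
      ∃ η : ℝ, 0 < η ∧ ∀ (ε : ℝ) (hε : 0 < ε), ε < η → x (dilate ε hε φ) = 0) :
    IsNull x := by
  refine ⟨N, fun q => (q : ℝ), ⟨fun a b h => Nat.cast_le.2 h, fun q => Nat.cast_nonneg q,
    tendsto_natCast_atTop_atTop⟩, fun q hq φ hφ => ?_⟩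
  obtain ⟨η, h0, h1⟩ := h φ (testSet_anti hq hφ)
  refine ⟨1, one_pos, min η 1, lt_min h0 one_pos, min_le_right _ _, fun ε hε hlt => ?_⟩
  rw [h1 ε hε (hlt.trans_le (min_le_left _ _)), abs_zero]
  positivity

variable (m 𝕜)

/-- The algebra `E_M(ℝ)` of moderate functions `A_0 → ℝ`. -/
def moderateReal : Subalgebra ℝ (A0 m 𝕜 → ℝ) where
  carrier := {x | IsModerate x}
  mul_mem' := fun hx hy => hx.mul hy
  add_mem' := fun hx hy => hx.add hy
  algebraMap_mem' := fun c => isModerate_const c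

/-- The ideal `N(ℝ)` of null functions in `E_M(ℝ)`. -/
def nullReal : Ideal (moderateReal m 𝕜) where
  carrier := {x | IsNull (x : A0 m 𝕜 → ℝ)}
  add_mem' := fun hx hy => hx.add hy
  zero_mem' := isNull_of_eventually_zero 0 fun _ _ => ⟨1, one_pos, fun _ _ _ => rfl⟩
  smul_mem' := fun c x hx => by
    have : IsNull ((x : A0 m 𝕜 → ℝ) * (c : A0 m 𝕜 → ℝ)) := IsNull.mul hx c.2
    simpa [mul_comm] using this

/-- The ring of generalized real numbers, `E_M(ℝ) / N(ℝ)`. -/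
def GenReal : Type _ := moderateReal m 𝕜 ⧸ nullReal m 𝕜

instance : CommRing (GenReal m 𝕜) :=
  inferInstanceAs (CommRing (moderateReal m 𝕜 ⧸ nullReal m 𝕜))

variable {m 𝕜}

/-- The class in the ring of generalized real numbers of a moderate function. -/
def GenReal.mk (x : A0 m 𝕜 → ℝ) (hx : IsModerate x) : GenReal m 𝕜 :=
  Ideal.Quotient.mk (nullReal m 𝕜) ⟨x, hx⟩

theorem GenReal.mk_eq_mk {x y : A0 m 𝕜 → ℝ} (hx : IsModerate x) (hy : IsModerate y) :
    GenReal.mk x hx = GenReal.mk y hy ↔ IsNull (x - y) :=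
  Ideal.Quotient.mk_eq_mk_iff_sub_mem (I := nullReal m 𝕜) ⟨x, hx⟩ ⟨y, hy⟩

theorem GenReal.mk_add_mk {x y : A0 m 𝕜 → ℝ} (hx : IsModerate x) (hy : IsModerate y) :
    GenReal.mk x hx + GenReal.mk y hy = GenReal.mk (x + y) (hx.add hy) := rfl

/-- The order on generalized real numbers: `a ≤ b` if and only if `b - a` has a representative
which is nonnegative on all of `A_0`. -/
instance : LE (GenReal m 𝕜) where
  le a b := ∃ (u : A0 m 𝕜 → ℝ) (hu : IsModerate u), GenReal.mk u hu = b - a ∧ ∀ φ, 0 ≤ u φ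

theorem GenReal.le_trans {a b c : GenReal m 𝕜} (h : a ≤ b) (k : b ≤ c) : a ≤ c := by
  obtain ⟨u, hu, h1, h2⟩ := h
  obtain ⟨v, hv, k1, k2⟩ := k
  refine ⟨u + v, hu.add hv, ?_, fun φ => add_nonneg (h2 φ) (k2 φ)⟩
  rw [← GenReal.mk_add_mk hu hv, h1, k1]
  ring

theorem GenReal.add_le_add {a b c d : GenReal m 𝕜} (h : a ≤ b) (k : c ≤ d) :
    a + c ≤ b + d := by
  obtain ⟨u, hu, h1, h2⟩ := h
  obtain ⟨v, hv, k1, k2⟩ := k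
  refine ⟨u + v, hu.add hv, ?_, fun φ => add_nonneg (h2 φ) (k2 φ)⟩
  rw [← GenReal.mk_add_mk hu hv, h1, k1]
  ring

/-- An inequality of representatives which holds on `φ_ε` for all small `ε`, for every `φ` in
some `A_N`, gives an inequality of generalized numbers. -/
theorem GenReal.mk_le_mk {x y : A0 m 𝕜 → ℝ} (hx : IsModerate x) (hy : IsModerate y) (N : ℕ)
    (h : ∀ φ : A0 m 𝕜, (φ : E m → 𝕜) ∈ testSet m 𝕜 N →
      ∃ η : ℝ, 0 < η ∧ ∀ (ε : ℝ) (hε : 0 < ε), ε < η →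
        x (dilate ε hε φ) ≤ y (dilate ε hε φ)) :
    GenReal.mk x hx ≤ GenReal.mk y hy := by
  have hneg : IsModerate (fun φ => -x φ) := hx.mono fun φ => by simp
  have hsub : IsModerate (fun φ => y φ - x φ) := by
    exact (hy.add hneg).mono fun φ => by simp [sub_eq_add_neg]
  have hmax : IsModerate (fun φ => max (y φ - x φ) 0) := hsub.mono fun φ => by
    rw [abs_of_nonneg (le_max_right _ _)]
    exact max_le (le_abs_self _) (abs_nonneg _)
  refine ⟨_, hmax, ?_, fun φ => le_max_right _ _⟩
  have e : GenReal.mk y hy - GenReal.mk x hx = GenReal.mk (fun φ => y φ - x φ) hsub := rfl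
  rw [e, GenReal.mk_eq_mk]
  refine isNull_of_eventually_zero N fun φ hφ => ?_
  obtain ⟨η, h0, h1⟩ := h φ hφ
  refine ⟨η, h0, fun ε hε hlt => ?_⟩
  have := h1 ε hε hlt
  simp only [Pi.sub_apply]
  rw [max_eq_left (by linarith), sub_self]

theorem isModerate_supportDiam_rpow (r : ℝ) :
    IsModerate (fun φ : A0 m 𝕜 => supportDiam φ ^ r) := by
  obtain ⟨N, hN⟩ := exists_nat_ge (-r)
  refine ⟨N, fun φ _ => ⟨supportDiam φ ^ r + 1, ?_, 1, one_pos, le_rfl, fun ε hε hlt => ?_⟩⟩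
  · have := Real.rpow_nonneg (supportDiam_nonneg φ) r
    positivity
  · have h0 := Real.rpow_nonneg (supportDiam_nonneg φ) r
    simp only [supportDiam_dilate]
    rw [Real.mul_rpow hε.le (supportDiam_nonneg φ),
      abs_of_nonneg (by positivity)]
    have h1 : ε ^ r ≤ ε ^ (-(N : ℝ)) :=
      Real.rpow_le_rpow_of_exponent_ge hε hlt.le (by linarith)
    have h2 : 0 ≤ ε ^ (-(N : ℝ)) := by positivity
    nlinarith

variable (m 𝕜)

/-- The generalized number `α_r`, the class of `φ ↦ i(φ)^r`. -/
def alpha (r : ℝ) : GenReal m 𝕜 :=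
  GenReal.mk (fun φ => supportDiam φ ^ r) (isModerate_supportDiam_rpow r)

variable {m 𝕜}

theorem zero_le_alpha (r : ℝ) : 0 ≤ alpha m 𝕜 r :=
  ⟨_, isModerate_supportDiam_rpow r, (sub_zero _).symm,
    fun φ => Real.rpow_nonneg (supportDiam_nonneg φ) r⟩

theorem exists_dilate_small (φ : A0 m 𝕜) (δ : ℝ) (hδ : 0 < δ) : ∃ η : ℝ, 0 < η ∧
    ∀ (ε : ℝ) (hε : 0 < ε), ε < η → supportDiam (dilate ε hε φ) ≤ δ := by
  have h := supportDiam_nonneg φ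
  refine ⟨δ / (supportDiam φ + 1), by positivity, fun ε hε hlt => ?_⟩
  rw [supportDiam_dilate]
  rw [lt_div_iff₀ (by positivity)] at hlt
  nlinarith

theorem alpha_anti {r s : ℝ} (hr : 0 < r) (h : r ≤ s) : alpha m 𝕜 s ≤ alpha m 𝕜 r := by
  refine GenReal.mk_le_mk _ _ 0 fun φ _ => ?_
  obtain ⟨η, h0, h1⟩ := exists_dilate_small φ 1 one_pos
  exact ⟨η, h0, fun ε hε hlt => Real.rpow_le_rpow_of_exponent_ge_of_imp
    (supportDiam_nonneg _) (h1 ε hε hlt) h fun _ h2 => absurd h2 (hr.trans_le h).ne'⟩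

theorem two_alpha_le {r : ℝ} (hr : 0 < r) :
    alpha m 𝕜 (r + 1) + alpha m 𝕜 (r + 1) ≤ alpha m 𝕜 r := by
  refine GenReal.mk_le_mk ((isModerate_supportDiam_rpow _).add
    (isModerate_supportDiam_rpow _)) _ 0 fun φ _ => ?_
  obtain ⟨η, h0, h1⟩ := exists_dilate_small φ (1 / 2) (by norm_num)
  refine ⟨η, h0, fun ε hε hlt => ?_⟩
  have h2 := h1 ε hε hlt
  have h3 := supportDiam_nonneg (dilate ε hε φ)
  have h4 := Real.rpow_nonneg h3 r
  simp only [Pi.add_apply]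
  rw [Real.rpow_add_of_nonneg h3 hr.le zero_le_one, Real.rpow_one]
  nlinarith

end Test

/-! ### Smooth functions on the closure of a bounded open set -/

/-- A bounded open subset of `ℝ^m`. -/
structure BoundedOpen (m : ℕ) where
  /-- the underlying set -/
  carrier : Set (E m)
  isOpen : IsOpen carrier
  isBounded : Bornology.IsBounded carrier

section Smooth

variable {m : ℕ} {𝕜 : Type*} [RCLike 𝕜]

/-- The closure of a bounded open set. -/
abbrev BoundedOpen.cl (ω : BoundedOpen m) : Set (E m) := closure ω.carrier

instance (ω : BoundedOpen m) : CompactSpace ω.cl :=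
  isCompact_iff_compactSpace.1 ω.isBounded.isCompact_closure

/-- The partial derivative `∂_i f`. -/
def partialDeriv (i : Fin m) (f : E m → 𝕜) : E m → 𝕜 :=
  fun x => fderiv ℝ f x (EuclideanSpace.single i 1)

/-- Iterated partial derivatives, in the directions given by a list. -/
def iterPartial : List (Fin m) → (E m → 𝕜) → E m → 𝕜
  | [], f => f
  | i :: L, f => iterPartial L (partialDeriv i f)

/-- A function `F` is smooth in the interior of `X` and all its partial derivatives there,
of all orders, extend continuously to `X`. -/
def SmoothUpTo (X : Set (E m)) (F : E m → 𝕜) : Prop :=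
  ContDiffOn ℝ (⊤ : ℕ∞) F (interior X) ∧ ∀ L : List (Fin m), ∃ g : C(X, 𝕜),
    ∀ (x : E m) (hx : x ∈ interior X), g ⟨x, interior_subset hx⟩ = iterPartial L F x

theorem partialDeriv_congr {U : Set (E m)} (hU : IsOpen U) {F G : E m → 𝕜}
    (h : Set.EqOn F G U) (i : Fin m) : Set.EqOn (partialDeriv i F) (partialDeriv i G) U := by
  intro x hx
  have : F =ᶠ[𝓝 x] G := h.eventuallyEq_of_mem (hU.mem_nhds hx)
  simp only [partialDeriv, this.fderiv_eq]

theorem iterPartial_congr {U : Set (E m)} (hU : IsOpen U) (L : List (Fin m)) :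
    ∀ {F G : E m → 𝕜}, Set.EqOn F G U → Set.EqOn (iterPartial L F) (iterPartial L G) U := by
  induction L with
  | nil => exact fun h => h
  | cons i L ih => exact fun h => ih (partialDeriv_congr hU h i)

theorem contDiffOn_partialDeriv {U : Set (E m)} (hU : IsOpen U) {F : E m → 𝕜}
    (h : ContDiffOn ℝ (⊤ : ℕ∞) F U) (i : Fin m) : ContDiffOn ℝ (⊤ : ℕ∞) (partialDeriv i F) U :=
  (h.fderiv_of_isOpen hU (by simp)).clm_apply contDiffOn_const

theorem SmoothUpTo.partialDeriv {X : Set (E m)} {F : E m → 𝕜} (h : SmoothUpTo X F)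
    (i : Fin m) : SmoothUpTo X (partialDeriv i F) :=
  ⟨contDiffOn_partialDeriv isOpen_interior h.1 i, fun L => h.2 (i :: L)⟩

theorem SmoothUpTo.congr {X : Set (E m)} {F G : E m → 𝕜} (h : SmoothUpTo X F)
    (hFG : Set.EqOn F G (interior X)) : SmoothUpTo X G := by
  refine ⟨h.1.congr fun x hx => (hFG hx).symm, fun L => ?_⟩
  obtain ⟨g, hg⟩ := h.2 L
  exact ⟨g, fun x hx => (hg x hx).trans (iterPartial_congr isOpen_interior L hFG hx)⟩

theorem differentiableAt_of_contDiffOn {U : Set (E m)} (hU : IsOpen U) {F : E m → 𝕜}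
    (h : ContDiffOn ℝ (⊤ : ℕ∞) F U) {x : E m} (hx : x ∈ U) : DifferentiableAt ℝ F x :=
  (h.contDiffAt (hU.mem_nhds hx)).differentiableAt (by simp)

theorem partialDeriv_add_eqOn {U : Set (E m)} (hU : IsOpen U) {F G : E m → 𝕜}
    (hF : ContDiffOn ℝ (⊤ : ℕ∞) F U) (hG : ContDiffOn ℝ (⊤ : ℕ∞) G U) (i : Fin m) :
    Set.EqOn (partialDeriv i (F + G)) (partialDeriv i F + partialDeriv i G) U := by
  intro x hx
  simp only [partialDeriv, Pi.add_apply]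
  rw [fderiv_add (differentiableAt_of_contDiffOn hU hF hx)
    (differentiableAt_of_contDiffOn hU hG hx)]
  rfl

theorem partialDeriv_mul_eqOn {U : Set (E m)} (hU : IsOpen U) {F G : E m → 𝕜}
    (hF : ContDiffOn ℝ (⊤ : ℕ∞) F U) (hG : ContDiffOn ℝ (⊤ : ℕ∞) G U) (i : Fin m) :
    Set.EqOn (partialDeriv i (F * G)) (F * partialDeriv i G + G * partialDeriv i F) U := by
  intro x hx
  simp only [partialDeriv, Pi.add_apply, Pi.mul_apply]
  rw [fderiv_mul (differentiableAt_of_contDiffOn hU hF hx)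
    (differentiableAt_of_contDiffOn hU hG hx)]
  rfl

theorem SmoothUpTo.add {X : Set (E m)} {F G : E m → 𝕜} (hF : SmoothUpTo X F)
    (hG : SmoothUpTo X G) : SmoothUpTo X (F + G) := by
  refine ⟨hF.1.add hG.1, fun L => ?_⟩
  induction L generalizing F G with
  | nil =>
    obtain ⟨f, hf⟩ := hF.2 []
    obtain ⟨g, hg⟩ := hG.2 []
    exact ⟨f + g, fun x hx => congrArg₂ (· + ·) (hf x hx) (hg x hx)⟩
  | cons i L ih =>
    obtain ⟨g, hg⟩ := ih (hF.partialDeriv i) (hG.partialDeriv i)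
    refine ⟨g, fun x hx => (hg x hx).trans ?_⟩
    exact (iterPartial_congr isOpen_interior L
      (partialDeriv_add_eqOn isOpen_interior hF.1 hG.1 i) hx).symm

theorem SmoothUpTo.mul {X : Set (E m)} {F G : E m → 𝕜} (hF : SmoothUpTo X F)
    (hG : SmoothUpTo X G) : SmoothUpTo X (F * G) := by
  suffices h : ∀ (L : List (Fin m)) {F G : E m → 𝕜}, SmoothUpTo X F → SmoothUpTo X G →
      ∀ K : List (Fin m), K.length ≤ L.length → ∃ g : C(X, 𝕜), ∀ (x : E m)
        (hx : x ∈ interior X), g ⟨x, interior_subset hx⟩ = iterPartial K (F * G) x from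
    ⟨hF.1.mul hG.1, fun L => h L hF hG L le_rfl⟩
  have hsum : ∀ (K : List (Fin m)) {F G : E m → 𝕜}, ContDiffOn ℝ (⊤ : ℕ∞) F (interior X) →
      ContDiffOn ℝ (⊤ : ℕ∞) G (interior X) → Set.EqOn (iterPartial K (F + G))
        (iterPartial K F + iterPartial K G) (interior X) := by
    intro K
    induction K with
    | nil => exact fun _ _ => fun _ _ => rfl
    | cons i K ih =>
      intro F G hF hG
      exact (iterPartial_congr isOpen_interior K
        (partialDeriv_add_eqOn isOpen_interior hF hG i)).trans
        (ih (contDiffOn_partialDeriv isOpen_interior hF i)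
          (contDiffOn_partialDeriv isOpen_interior hG i))
  intro L
  induction L with
  | nil =>
    intro F G hF hG K hK
    obtain rfl : K = [] := List.length_eq_zero_iff.1 (Nat.le_zero.1 hK)
    obtain ⟨f, hf⟩ := hF.2 []
    obtain ⟨g, hg⟩ := hG.2 []
    exact ⟨f * g, fun x hx => congrArg₂ (· * ·) (hf x hx) (hg x hx)⟩
  | cons j L ih =>
    intro F G hF hG K hK
    cases K with
    | nil => exact ih hF hG [] (Nat.zero_le _)
    | cons i K =>
      have hK' : K.length ≤ L.length := by simpa using hK
      obtain ⟨f, hf⟩ := ih hF (hG.partialDeriv i) K hK'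
      obtain ⟨g, hg⟩ := ih hG (hF.partialDeriv i) K hK'
      refine ⟨f + g, fun x hx => ?_⟩
      have h1 := iterPartial_congr isOpen_interior K
        (partialDeriv_mul_eqOn isOpen_interior hF.1 hG.1 i) hx
      have h2 := hsum K (hF.1.mul (hG.partialDeriv i).1) (hG.1.mul (hF.partialDeriv i).1) hx
      exact ((congrArg₂ (· + ·) (hf x hx) (hg x hx)).trans h2.symm).trans h1.symm

theorem smoothUpTo_const (X : Set (E m)) (c : 𝕜) : SmoothUpTo X (fun _ => c) := by
  refine ⟨contDiffOn_const, fun L => ?_⟩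
  have h : ∀ (L : List (Fin m)) (c : 𝕜), ∃ d : 𝕜, iterPartial L (fun _ : E m => c) =
      fun _ => d := by
    intro L
    induction L with
    | nil => exact fun c => ⟨c, rfl⟩
    | cons i L ih =>
      intro c
      have : partialDeriv i (fun _ : E m => c) = fun _ => 0 := by
        ext x
        simp [partialDeriv]
      simp only [iterPartial, this]
      exact ih 0
  obtain ⟨d, hd⟩ := h L c
  exact ⟨ContinuousMap.const _ d, fun x _ => by rw [hd]; rfl⟩

/-- Extension by zero of a function on `X` to `ℝ^m`. Only its values on `X` matter below. -/
def extendZero {X : Set (E m)} (f : X → 𝕜) : E m → 𝕜 := Function.extend Subtype.val f 0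

theorem extendZero_apply {X : Set (E m)} (f : X → 𝕜) (x : X) : extendZero f x = f x :=
  Subtype.val_injective.extend_apply f 0 x

variable (𝕜)

/-- The algebra `C^∞(ω̄; 𝕜)` of the continuous functions on the closure of `ω` which are smooth
in its interior and whose partial derivatives of all orders extend continuously to the
closure. -/
def Smooth (ω : BoundedOpen m) : Subalgebra 𝕜 C(ω.cl, 𝕜) where
  carrier := {f | SmoothUpTo ω.cl (extendZero f)}
  mul_mem' := fun {f g} hf hg => (SmoothUpTo.mul hf hg).congr fun x hx => by
    have hx' := interior_subset hx
    have h := fun k : C(ω.cl, 𝕜) => extendZero_apply k ⟨x, hx'⟩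
    exact (congrArg₂ (· * ·) (h f) (h g)).trans (h (f * g)).symm
  add_mem' := fun {f g} hf hg => (SmoothUpTo.add hf hg).congr fun x hx => by
    have hx' := interior_subset hx
    have h := fun k : C(ω.cl, 𝕜) => extendZero_apply k ⟨x, hx'⟩
    exact (congrArg₂ (· + ·) (h f) (h g)).trans (h (f + g)).symm
  algebraMap_mem' := fun c => (smoothUpTo_const ω.cl c).congr fun x hx => by
    have hx' := interior_subset hx
    exact (extendZero_apply (algebraMap 𝕜 C(ω.cl, 𝕜) c) ⟨x, hx'⟩).symm

variable {𝕜}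

theorem subset_interior_cl (ω : BoundedOpen m) : ω.carrier ⊆ interior ω.cl :=
  interior_maximal subset_closure ω.isOpen

theorem eq_of_eqOn_interior {ω : BoundedOpen m} {f g : C(ω.cl, 𝕜)}
    (h : ∀ (x : E m) (hx : x ∈ interior ω.cl), f ⟨x, interior_subset hx⟩ =
      g ⟨x, interior_subset hx⟩) : f = g := by
  have hd : DenseRange (Set.inclusion (subset_closure (s := ω.carrier))) :=
    (denseRange_inclusion_iff subset_closure).2 le_rfl
  apply ContinuousMap.coe_injective
  refine hd.equalizer f.continuous g.continuous ?_
  ext x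
  exact h x.1 (subset_interior_cl ω x.2)

theorem exists_partial {ω : BoundedOpen m} (i : Fin m) (f : Smooth 𝕜 ω) :
    ∃ g : Smooth 𝕜 ω, ∀ (x : E m) (hx : x ∈ interior ω.cl),
      g.1 ⟨x, interior_subset hx⟩ = partialDeriv i (extendZero f.1) x := by
  obtain ⟨g, hg⟩ := f.2.2 [i]
  refine ⟨⟨g, (f.2.partialDeriv i).congr fun x hx => ?_⟩, hg⟩
  exact (hg x hx).symm.trans (extendZero_apply g ⟨x, interior_subset hx⟩).symm

/-- The continuous extension to the closure of `ω` of the partial derivative `∂_i f`. -/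
def partialFun {ω : BoundedOpen m} (i : Fin m) (f : Smooth 𝕜 ω) : Smooth 𝕜 ω :=
  (exists_partial i f).choose

theorem partialFun_spec {ω : BoundedOpen m} (i : Fin m) (f : Smooth 𝕜 ω) (x : E m)
    (hx : x ∈ interior ω.cl) :
    (partialFun i f).1 ⟨x, interior_subset hx⟩ = partialDeriv i (extendZero f.1) x :=
  (exists_partial i f).choose_spec x hx

theorem partialFun_add {ω : BoundedOpen m} (i : Fin m) (f g : Smooth 𝕜 ω) :
    partialFun i (f + g) = partialFun i f + partialFun i g := by
  refine Subtype.ext (eq_of_eqOn_interior fun x hx => ?_)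
  have h := fun (k : C(ω.cl, 𝕜)) {y : E m} (hy : y ∈ interior ω.cl) =>
    extendZero_apply k ⟨y, interior_subset hy⟩
  have e : Set.EqOn (extendZero (f + g : Smooth 𝕜 ω).1) (extendZero f.1 + extendZero g.1)
      (interior ω.cl) := fun y hy =>
    (h (f + g : Smooth 𝕜 ω).1 hy).trans (congrArg₂ (· + ·) (h f.1 hy) (h g.1 hy)).symm
  rw [partialFun_spec i _ x hx, partialDeriv_congr isOpen_interior e i hx,
    partialDeriv_add_eqOn isOpen_interior f.2.1 g.2.1 i hx]
  exact (congrArg₂ (· + ·) (partialFun_spec i f x hx) (partialFun_spec i g x hx)).symm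

theorem partialFun_mul {ω : BoundedOpen m} (i : Fin m) (f g : Smooth 𝕜 ω) :
    partialFun i (f * g) = f * partialFun i g + g * partialFun i f := by
  refine Subtype.ext (eq_of_eqOn_interior fun x hx => ?_)
  have h := fun (k : C(ω.cl, 𝕜)) {y : E m} (hy : y ∈ interior ω.cl) =>
    extendZero_apply k ⟨y, interior_subset hy⟩
  have e : Set.EqOn (extendZero (f * g : Smooth 𝕜 ω).1) (extendZero f.1 * extendZero g.1)
      (interior ω.cl) := fun y hy =>
    (h (f * g : Smooth 𝕜 ω).1 hy).trans (congrArg₂ (· * ·) (h f.1 hy) (h g.1 hy)).symm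
  rw [partialFun_spec i _ x hx, partialDeriv_congr isOpen_interior e i hx,
    partialDeriv_mul_eqOn isOpen_interior f.2.1 g.2.1 i hx]
  exact congrArg₂ (· + ·) (congrArg₂ (· * ·) (h f.1 hx) (partialFun_spec i g x hx).symm)
    (congrArg₂ (· * ·) (h g.1 hx) (partialFun_spec i f x hx).symm)

theorem partialFun_algebraMap {ω : BoundedOpen m} (i : Fin m) (c : 𝕜) :
    partialFun i (algebraMap 𝕜 (Smooth 𝕜 ω) c) = 0 := by
  refine Subtype.ext (eq_of_eqOn_interior fun x hx => ?_)
  have e : Set.EqOn (extendZero (algebraMap 𝕜 (Smooth 𝕜 ω) c).1) (fun _ => c)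
      (interior ω.cl) := fun y hy =>
    extendZero_apply (algebraMap 𝕜 (Smooth 𝕜 ω) c).1 ⟨y, interior_subset hy⟩
  rw [partialFun_spec i _ x hx, partialDeriv_congr isOpen_interior e i hx]
  simp [partialDeriv]

/-- The partial derivative `∂_i`, as a linear operator on `C^∞(ω̄; 𝕜)`. -/
def pd {ω : BoundedOpen m} (i : Fin m) : Module.End 𝕜 (Smooth 𝕜 ω) where
  toFun := partialFun i
  map_add' := partialFun_add i
  map_smul' := fun c f => by
    rw [Algebra.smul_def, partialFun_mul, partialFun_algebraMap]
    simp [Algebra.smul_def]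

theorem pd_mul {ω : BoundedOpen m} (i : Fin m) (f g : Smooth 𝕜 ω) :
    pd i (f * g) = f * pd i g + g * pd i f := partialFun_mul i f g

/-- The product `∂_{i_1}^{σ(i_1)} ∂_{i_2}^{σ(i_2)} ⋯` along a list `i_1, i_2, …`. -/
def derivAlong {ω : BoundedOpen m} (l : List (Fin m)) (σ : MultiIndex m) :
    Module.End 𝕜 (Smooth 𝕜 ω) := (l.map fun i => pd i ^ σ i).prod

/-- The partial derivative `∂^σ = ∂_1^{σ_1} ⋯ ∂_m^{σ_m}` on `C^∞(ω̄; 𝕜)`. -/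
def multiDeriv {ω : BoundedOpen m} (σ : MultiIndex m) : Module.End 𝕜 (Smooth 𝕜 ω) :=
  derivAlong (List.finRange m) σ

/-- For a net `u : A_0 → C^∞(ω̄; 𝕜)` and a multi-index `σ`, the function
`u_σ : φ ↦ ‖∂^σ u(φ, ·)‖`, the sup norm over the closure of `ω`. -/
def supNorm {ω : BoundedOpen m} (σ : MultiIndex m) (u : A0 m 𝕜 → Smooth 𝕜 ω) : A0 m 𝕜 → ℝ :=
  fun φ => ‖(multiDeriv σ (u φ) : C(ω.cl, 𝕜))‖

theorem supNorm_nonneg {ω : BoundedOpen m} (σ : MultiIndex m) (u : A0 m 𝕜 → Smooth 𝕜 ω)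
    (φ : A0 m 𝕜) : 0 ≤ supNorm σ u φ := norm_nonneg _

theorem supNorm_add_le {ω : BoundedOpen m} (σ : MultiIndex m) (u v : A0 m 𝕜 → Smooth 𝕜 ω)
    (φ : A0 m 𝕜) : supNorm σ (u + v) φ ≤ supNorm σ u φ + supNorm σ v φ := by
  simp only [supNorm, Pi.add_apply, map_add]
  exact norm_add_le _ _

theorem supNorm_neg {ω : BoundedOpen m} (σ : MultiIndex m) (u : A0 m 𝕜 → Smooth 𝕜 ω) :
    supNorm σ (-u) = supNorm σ u := by
  funext φ
  simp only [supNorm, Pi.neg_apply, map_neg]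
  exact norm_neg _

/-! ### The full Colombeau algebra on the closure of `ω` -/

/-- Moderate nets: all functions `u_σ` are moderate. -/
def IsModerateNet {ω : BoundedOpen m} (u : A0 m 𝕜 → Smooth 𝕜 ω) : Prop :=
  ∀ σ : MultiIndex m, IsModerate (supNorm σ u)

/-- Null nets: all functions `u_σ` are null. -/
def IsNullNet {ω : BoundedOpen m} (u : A0 m 𝕜 → Smooth 𝕜 ω) : Prop :=
  ∀ σ : MultiIndex m, IsNull (supNorm σ u)

/-- Auxiliary recursion for products: the property `R` holds for all the nets obtained by
applying powers of the partial derivatives along a list. -/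
def AllDerivs {ω : BoundedOpen m} (R : (A0 m 𝕜 → Smooth 𝕜 ω) → Prop) :
    List (Fin m) → (A0 m 𝕜 → Smooth 𝕜 ω) → Prop
  | [], u => R u
  | i :: l, u => ∀ a : ℕ, AllDerivs R l (fun φ => (pd i ^ a) (u φ))

theorem allDerivs_iff {ω : BoundedOpen m} (R : (A0 m 𝕜 → Smooth 𝕜 ω) → Prop)
    (l : List (Fin m)) (hl : l.Nodup) : ∀ u : A0 m 𝕜 → Smooth 𝕜 ω, AllDerivs R l u ↔
      ∀ σ : MultiIndex m, R (fun φ => derivAlong l.reverse σ (u φ)) := by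
  induction l with
  | nil => exact fun u => ⟨fun h _ => h, fun h => h 0⟩
  | cons i l ih =>
    intro u
    obtain ⟨hi, hl⟩ := List.nodup_cons.1 hl
    have hc : ∀ σ : MultiIndex m, derivAlong (𝕜 := 𝕜) (ω := ω) (i :: l).reverse σ =
        derivAlong l.reverse σ * pd i ^ σ i := fun σ => by simp [derivAlong]
    constructor
    · intro h σ
      rw [hc]
      exact (ih hl _).1 (h (σ i)) σ
    · intro h a
      refine (ih hl _).2 fun σ => ?_
      have h' := h (Function.update σ i a)
      rw [hc, Function.update_self] at h'
      have e : derivAlong (𝕜 := 𝕜) (ω := ω) l.reverse (Function.update σ i a) =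
          derivAlong l.reverse σ := by
        unfold derivAlong
        congr 1
        refine List.map_congr_left fun j hj => ?_
        rw [Function.update_of_ne]
        rintro rfl
        exact hi (List.mem_reverse.1 hj)
      rw [e] at h'
      exact h'

theorem allDerivs_finRange_iff {ω : BoundedOpen m} (R : (A0 m 𝕜 → Smooth 𝕜 ω) → Prop)
    (u : A0 m 𝕜 → Smooth 𝕜 ω) : AllDerivs R (List.finRange m).reverse u ↔
      ∀ σ : MultiIndex m, R (fun φ => multiDeriv σ (u φ)) := by
  rw [allDerivs_iff R _ (List.nodup_reverse.2 (List.nodup_finRange m))]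
  simp [multiDeriv]

theorem AllDerivs.add {ω : BoundedOpen m} {R : (A0 m 𝕜 → Smooth 𝕜 ω) → Prop}
    (hR : ∀ u v, R u → R v → R (u + v)) (l : List (Fin m)) :
    ∀ {u v : A0 m 𝕜 → Smooth 𝕜 ω}, AllDerivs R l u → AllDerivs R l v →
      AllDerivs R l (u + v) := by
  induction l with
  | nil => exact fun hu hv => hR _ _ hu hv
  | cons i l ih =>
    intro u v hu hv a
    have h := ih (hu a) (hv a)
    have e : (fun φ => (pd i ^ a) ((u + v) φ)) =
        (fun φ => (pd i ^ a) (u φ)) + fun φ => (pd i ^ a) (v φ) := by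
      funext φ
      simp only [Pi.add_apply, map_add]
    rw [e]
    exact h

theorem AllDerivs.mul {ω : BoundedOpen m} {R S : (A0 m 𝕜 → Smooth 𝕜 ω) → Prop}
    (hR : ∀ u v, R u → R v → R (u + v)) (hRS : ∀ u v, R u → S v → R (u * v))
    (l : List (Fin m)) : ∀ {u v : A0 m 𝕜 → Smooth 𝕜 ω}, AllDerivs R l u → AllDerivs S l v →
      AllDerivs R l (u * v) := by
  induction l with
  | nil => exact fun hu hv => hRS _ _ hu hv
  | cons i l ih =>
    intro u v hu hv a
    induction a generalizing u v with
    | zero => exact ih (hu 0) (hv 0)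
    | succ a iha =>
      have shift : ∀ {T : (A0 m 𝕜 → Smooth 𝕜 ω) → Prop} {w : A0 m 𝕜 → Smooth 𝕜 ω},
          AllDerivs T (i :: l) w → AllDerivs T (i :: l) (fun φ => pd i (w φ)) := by
        intro T w hw b
        have := hw (b + 1)
        simpa only [pow_succ, Module.End.mul_apply] using this
      have h1 := iha hu (shift hv)
      have h2 := iha (shift hu) hv
      have h3 := AllDerivs.add hR l h1 h2
      have e : (fun φ => (pd i ^ (a + 1)) ((u * v) φ)) =
          (fun φ => (pd i ^ a) ((u * fun φ => pd i (v φ)) φ)) +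
            fun φ => (pd i ^ a) (((fun φ => pd i (u φ)) * v) φ) := by
        funext φ
        simp only [pow_succ, Module.End.mul_apply, Pi.mul_apply, Pi.add_apply, pd_mul, map_add]
        rw [mul_comm (v φ)]
      rw [e]
      exact h3

theorem isModerateNet_iff {ω : BoundedOpen m} (u : A0 m 𝕜 → Smooth 𝕜 ω) : IsModerateNet u ↔
    AllDerivs (fun w => IsModerate fun φ => ‖(w φ : C(ω.cl, 𝕜))‖)
      (List.finRange m).reverse u :=
  (allDerivs_finRange_iff (fun w : A0 m 𝕜 → Smooth 𝕜 ω =>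
    IsModerate fun φ => ‖(w φ : C(ω.cl, 𝕜))‖) u).symm

theorem isNullNet_iff {ω : BoundedOpen m} (u : A0 m 𝕜 → Smooth 𝕜 ω) : IsNullNet u ↔
    AllDerivs (fun w => IsNull fun φ => ‖(w φ : C(ω.cl, 𝕜))‖)
      (List.finRange m).reverse u :=
  (allDerivs_finRange_iff (fun w : A0 m 𝕜 → Smooth 𝕜 ω =>
    IsNull fun φ => ‖(w φ : C(ω.cl, 𝕜))‖) u).symm

theorem abs_norm_add_le {V : Type*} [SeminormedAddCommGroup V] (x y : V) :
    |‖x + y‖| ≤ |‖x‖ + ‖y‖| := by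
  rw [abs_of_nonneg (norm_nonneg _), abs_of_nonneg (by positivity)]
  exact norm_add_le x y

theorem abs_norm_mul_le {V : Type*} [NonUnitalSeminormedRing V] (x y : V) :
    |‖x * y‖| ≤ |‖x‖ * ‖y‖| := by
  rw [abs_of_nonneg (norm_nonneg _), abs_of_nonneg (by positivity)]
  exact norm_mul_le x y

theorem IsModerateNet.add {ω : BoundedOpen m} {u v : A0 m 𝕜 → Smooth 𝕜 ω}
    (hu : IsModerateNet u) (hv : IsModerateNet v) : IsModerateNet (u + v) := by
  rw [isModerateNet_iff] at *
  exact AllDerivs.add (fun w z hw hz => (IsModerate.add hw hz).mono fun φ =>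
    abs_norm_add_le _ _) _ hu hv

theorem IsModerateNet.mul {ω : BoundedOpen m} {u v : A0 m 𝕜 → Smooth 𝕜 ω}
    (hu : IsModerateNet u) (hv : IsModerateNet v) : IsModerateNet (u * v) := by
  rw [isModerateNet_iff] at *
  exact AllDerivs.mul (fun w z hw hz => (IsModerate.add hw hz).mono fun φ =>
    abs_norm_add_le _ _) (fun w z hw hz => (IsModerate.mul hw hz).mono fun φ =>
    abs_norm_mul_le _ _) _ hu hv

theorem IsNullNet.add {ω : BoundedOpen m} {u v : A0 m 𝕜 → Smooth 𝕜 ω}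
    (hu : IsNullNet u) (hv : IsNullNet v) : IsNullNet (u + v) := by
  rw [isNullNet_iff] at *
  exact AllDerivs.add (fun w z hw hz => (IsNull.add hw hz).mono fun φ =>
    abs_norm_add_le _ _) _ hu hv

theorem IsNullNet.mul {ω : BoundedOpen m} {u v : A0 m 𝕜 → Smooth 𝕜 ω}
    (hu : IsNullNet u) (hv : IsModerateNet v) : IsNullNet (u * v) := by
  rw [isNullNet_iff] at *
  rw [isModerateNet_iff] at hv
  exact AllDerivs.mul (fun w z hw hz => (IsNull.add hw hz).mono fun φ =>
    abs_norm_add_le _ _) (fun w z hw hz => (IsNull.mul hw hz).mono fun φ =>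
    abs_norm_mul_le _ _) _ hu hv

theorem isModerateNet_const {ω : BoundedOpen m} (f : Smooth 𝕜 ω) :
    IsModerateNet (fun _ : A0 m 𝕜 => f) := fun _ => isModerate_const _

theorem isNullNet_zero {ω : BoundedOpen m} :
    IsNullNet (0 : A0 m 𝕜 → Smooth 𝕜 ω) := fun σ =>
  isNull_of_eventually_zero 0 fun φ _ => ⟨1, one_pos, fun ε hε _ => by simp [supNorm]⟩

variable (𝕜)

/-- The algebra `E_M[ω̄]` of moderate nets. -/
def moderateNets (ω : BoundedOpen m) : Subalgebra 𝕜 (A0 m 𝕜 → Smooth 𝕜 ω) where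
  carrier := {u | IsModerateNet u}
  mul_mem' := fun hu hv => hu.mul hv
  add_mem' := fun hu hv => hu.add hv
  algebraMap_mem' := fun c => isModerateNet_const (algebraMap 𝕜 (Smooth 𝕜 ω) c)

instance (ω : BoundedOpen m) : CommRing (moderateNets 𝕜 ω) := Subalgebra.toCommRing _

/-- The ideal `N[ω̄]` of null nets in `E_M[ω̄]`. -/
def nullNets (ω : BoundedOpen m) : Ideal (moderateNets 𝕜 ω) where
  carrier := {u | IsNullNet (u : A0 m 𝕜 → Smooth 𝕜 ω)}
  add_mem' := fun hu hv => hu.add hv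
  zero_mem' := isNullNet_zero
  smul_mem' := fun c u hu => by
    have : IsNullNet ((u : A0 m 𝕜 → Smooth 𝕜 ω) * (c : A0 m 𝕜 → Smooth 𝕜 ω)) :=
      IsNullNet.mul hu c.2
    rw [mul_comm] at this
    exact this

/-- The full Colombeau algebra `G(ω̄) = E_M[ω̄] / N[ω̄]`. -/
def ColombeauAlgebra (ω : BoundedOpen m) : Type _ := moderateNets 𝕜 ω ⧸ nullNets 𝕜 ω

instance (ω : BoundedOpen m) : CommRing (ColombeauAlgebra 𝕜 ω) :=
  inferInstanceAs (CommRing (moderateNets 𝕜 ω ⧸ nullNets 𝕜 ω))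

instance (ω : BoundedOpen m) : Algebra 𝕜 (ColombeauAlgebra 𝕜 ω) :=
  inferInstanceAs (Algebra 𝕜 (moderateNets 𝕜 ω ⧸ nullNets 𝕜 ω))

variable {𝕜}

/-- The class in `G(ω̄)` of a moderate net. -/
def ColombeauAlgebra.mk {ω : BoundedOpen m} (u : moderateNets 𝕜 ω) : ColombeauAlgebra 𝕜 ω :=
  Ideal.Quotient.mk (nullNets 𝕜 ω) u

/-! ### The seminorms, the sets `W_{σ,r}` and the topology -/

theorem genSeminorm_wd {ω : BoundedOpen m} (σ : MultiIndex m) (u v : moderateNets 𝕜 ω)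
    (h : u - v ∈ nullNets 𝕜 ω) :
    GenReal.mk (supNorm σ u.1) (u.2 σ) = GenReal.mk (supNorm σ v.1) (v.2 σ) := by
  rw [GenReal.mk_eq_mk]
  refine (h σ).mono fun φ => ?_
  have e : (u - v : moderateNets 𝕜 ω).1 φ = u.1 φ - v.1 φ := rfl
  simp only [Pi.sub_apply, supNorm, abs_norm, e, map_sub]
  exact abs_norm_sub_norm_le _ _

/-- The generalized seminorm `‖f‖_σ`, the class of `φ ↦ ‖∂^σ u(φ, ·)‖` for any
representative `u` of `f`. -/
def genSeminorm {ω : BoundedOpen m} (σ : MultiIndex m) (f : ColombeauAlgebra 𝕜 ω) :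
    GenReal m 𝕜 :=
  Quotient.liftOn' f (fun u : moderateNets 𝕜 ω => GenReal.mk (supNorm σ u.1) (u.2 σ))
    fun u v h => genSeminorm_wd σ u v ((Submodule.quotientRel_def _).1 h)

theorem genSeminorm_mk {ω : BoundedOpen m} (σ : MultiIndex m) (u : moderateNets 𝕜 ω) :
    genSeminorm σ (ColombeauAlgebra.mk u) = GenReal.mk (supNorm σ u.1) (u.2 σ) := rfl

theorem ColombeauAlgebra.exists_rep {ω : BoundedOpen m} (f : ColombeauAlgebra 𝕜 ω) :
    ∃ u : moderateNets 𝕜 ω, ColombeauAlgebra.mk u = f :=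
  Ideal.Quotient.mk_surjective f

theorem genSeminorm_zero {ω : BoundedOpen m} (σ : MultiIndex m) :
    genSeminorm σ (0 : ColombeauAlgebra 𝕜 ω) = 0 := by
  have h : genSeminorm σ (ColombeauAlgebra.mk (0 : moderateNets 𝕜 ω)) = GenReal.mk 0 _ :=
    (GenReal.mk_eq_mk ((0 : moderateNets 𝕜 ω).2 σ) (moderateReal m 𝕜).zero_mem).2
      (isNull_of_eventually_zero 0 fun φ _ =>
        ⟨1, one_pos, fun ε hε _ => by simp [supNorm]⟩)
  exact h

theorem genSeminorm_neg {ω : BoundedOpen m} (σ : MultiIndex m) (f : ColombeauAlgebra 𝕜 ω) :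
    genSeminorm σ (-f) = genSeminorm σ f := by
  obtain ⟨u, rfl⟩ := f.exists_rep
  have h := supNorm_neg σ u.1
  change GenReal.mk (supNorm σ (-u.1)) _ = GenReal.mk (supNorm σ u.1) _
  congr 1

theorem genSeminorm_add_le {ω : BoundedOpen m} (σ : MultiIndex m)
    (f g : ColombeauAlgebra 𝕜 ω) :
    genSeminorm σ (f + g) ≤ genSeminorm σ f + genSeminorm σ g := by
  obtain ⟨u, rfl⟩ := f.exists_rep
  obtain ⟨v, rfl⟩ := g.exists_rep
  exact GenReal.mk_le_mk ((u + v).2 σ) ((u.2 σ).add (v.2 σ)) 0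
    fun φ _ => ⟨1, one_pos, fun ε hε _ => supNorm_add_le σ u.1 v.1 _⟩

variable (𝕜)

/-- `W_{σ,r} = {f ∈ G(ω̄) : ‖f‖_κ ≤ α_r for all κ ≤ σ}`. -/
def W (ω : BoundedOpen m) (σ : MultiIndex m) (r : ℝ) : Set (ColombeauAlgebra 𝕜 ω) :=
  {f | ∀ κ ≤ σ, genSeminorm κ f ≤ alpha m 𝕜 r}

/-- The family of the sets `W_{σ,r}`, with `σ ∈ ℕ^m` and `r` a positive integer, as a basis of
neighbourhoods of zero for a group topology on `G(ω̄)`. -/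
abbrev basisW (ω : BoundedOpen m) : AddGroupFilterBasis (ColombeauAlgebra 𝕜 ω) :=
  addGroupFilterBasisOfComm
    {U | ∃ (σ : MultiIndex m) (r : ℕ), 1 ≤ r ∧ U = W 𝕜 ω σ r}
    ⟨_, 0, 1, le_rfl, rfl⟩
    (by
      rintro _ _ ⟨σ, r, hr, rfl⟩ ⟨τ, s, hs, rfl⟩
      refine ⟨_, ⟨σ ⊔ τ, max r s, hr.trans (le_max_left _ _), rfl⟩, fun f hf => ⟨?_, ?_⟩⟩
      · exact fun κ hκ => GenReal.le_trans (hf κ (hκ.trans le_sup_left))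
          (alpha_anti (by exact_mod_cast hr) (by exact_mod_cast le_max_left r s))
      · exact fun κ hκ => GenReal.le_trans (hf κ (hκ.trans le_sup_right))
          (alpha_anti (by exact_mod_cast hs) (by exact_mod_cast le_max_right r s)))
    (by
      rintro _ ⟨σ, r, hr, rfl⟩ κ _
      rw [genSeminorm_zero]
      exact zero_le_alpha _)
    (by
      rintro _ ⟨σ, r, hr, rfl⟩
      refine ⟨_, ⟨σ, r + 1, by omega, rfl⟩, ?_⟩
      rintro _ ⟨f, hf, g, hg, rfl⟩ κ hκ
      refine GenReal.le_trans (genSeminorm_add_le κ f g) ?_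
      refine GenReal.le_trans (GenReal.add_le_add (hf κ hκ) (hg κ hκ)) ?_
      push_cast
      exact two_alpha_le (by exact_mod_cast hr))
    (by
      rintro _ ⟨σ, r, hr, rfl⟩
      refine ⟨_, ⟨σ, r, hr, rfl⟩, fun f hf κ hκ => ?_⟩
      rw [genSeminorm_neg]
      exact hf κ hκ)

/-- The topology `T_{ω̄,b}` on `G(ω̄)`: the translation invariant topology for which the sets
`W_{σ,r}` form a fundamental system of neighbourhoods of zero. -/
instance (ω : BoundedOpen m) : TopologicalSpace (ColombeauAlgebra 𝕜 ω) :=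
  (basisW 𝕜 ω).topology

instance (ω : BoundedOpen m) : IsTopologicalAddGroup (ColombeauAlgebra 𝕜 ω) :=
  AddGroupFilterBasis.isTopologicalAddGroup (basisW 𝕜 ω)

/-- The uniform structure of the topological group `(G(ω̄), T_{ω̄,b})`. -/
instance (ω : BoundedOpen m) : UniformSpace (ColombeauAlgebra 𝕜 ω) :=
  IsTopologicalAddGroup.rightUniformSpace (ColombeauAlgebra 𝕜 ω)

end Smooth

end FullColombeau

end

/-! The uniformity is countably generated, so it suffices to find limits for sequences that are
Cauchy at a prescribed rate: representatives `u n` for which `u (n+1) - u n` lies in the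
neighbourhood of order `n` and exponent `n + 1`. Each such difference has derivatives of order at
most `n` in every coordinate of size `O(ε^(n+1))`, but only along test functions in some `A_(M n)`,
and with constants that depend on `φ` and `n` in an uncontrolled way. An infinite series of
differences is therefore out of reach.

The remedy is a diagonal choice governed by moments. In positive dimension no test function has all
its moments of positive order zero (`exists_notMem_testSet`), so the least `n` with `φ ∉ A_(max n (M
n))` is a finite number `d φ`. Put `v φ = u (d φ) φ`. Dilation preserves every `A_q`, hence `d` is
constant along `φ_ε`, and `v - u k` is there a fixed finite telescoping sum (`boundedBy_telescope`),
of size `O(ε^(k+1))` as soon as `k ≤ d φ`. The latter holds on a whole `A_P`, which is what the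
generalized order asks for (`exists_limit_net`).

Passing between the order on generalized numbers and such estimates is the role of
`exists_boundedBy_of_le_alpha` and `mk_le_alpha`. Dimension zero is separate: there all the
`W_{σ,r}` with `r > 0` coincide (`W_eq_of_dim_zero`). -/

namespace FullColombeau

/-! ### Moments, supports and dilations of test functions -/

section TestFunctions

variable {m : ℕ} {𝕜 : Type*} [RCLike 𝕜]

/-- A function with all moments of positive order zero acts on polynomials in one coordinate as the
Dirac mass at the origin: only the constant term survives. -/
theorem integral_eval_smul {φ : E m → 𝕜} (hφ : ∀ q, φ ∈ testSet m 𝕜 q) (i : Fin m)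
    (p : Polynomial ℝ) : ∫ x, p.eval (x i) • φ x = ((p.eval 0 : ℝ) : 𝕜) := by
  have hc : Continuous φ := (hφ 0).1.continuous
  have hint : ∀ p : Polynomial ℝ, Integrable (fun x : E m => p.eval (x i) • φ x) := fun p =>
    ((p.continuous.comp (EuclideanSpace.proj (𝕜 := ℝ) i).continuous).smul hc)
      |>.integrable_of_hasCompactSupport
        ((hφ 0).2.1.smul_left (f := fun x : E m => p.eval (x i)))
  induction p using Polynomial.induction_on' with
  | add p q hp hq =>
    simp only [Polynomial.eval_add, add_smul]
    rw [integral_add (hint p) (hint q), hp, hq]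
    push_cast
    rfl
  | monomial k a =>
    simp only [Polynomial.eval_monomial, mul_smul]
    rw [integral_smul]
    rcases Nat.eq_zero_or_pos k with rfl | hk
    · simp [(hφ 0).2.2.1, RCLike.real_smul_eq_coe_mul]
    · have h := (hφ k).2.2.2 (Pi.single i k) (by simp; omega) (by simp)
      have e : ∀ x : E m, ∏ j, x j ^ (Pi.single i k : Fin m → ℕ) j = x i ^ k := fun x => by
        rw [Finset.prod_eq_single i (fun j _ hj => by simp [hj]) (by simp)]
        simp
      simp only [e] at h
      rw [h]
      simp [hk.ne']

theorem volume_coordinate_zero (i : Fin m) : volume {x : E m | x i = 0} = 0 := by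
  have h := Measure.addHaar_submodule (volume : Measure (E m))
    (LinearMap.ker (EuclideanSpace.proj (𝕜 := ℝ) i : E m →L[ℝ] ℝ).toLinearMap) (fun h => by
      have : EuclideanSpace.single i (1 : ℝ) ∈
          LinearMap.ker (EuclideanSpace.proj (𝕜 := ℝ) i : E m →L[ℝ] ℝ).toLinearMap := by
        rw [h]; trivial
      simp at this)
  convert h using 2
  ext x
  simp

/-- In positive dimension no test function has all moments of positive order zero. -/
theorem exists_notMem_testSet (i : Fin m) (φ : E m → 𝕜) : ∃ q, φ ∉ testSet m 𝕜 q := by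
  by_contra! hφ
  obtain ⟨R, hR0, hR⟩ := (hφ 0).2.1.isCompact.isBounded.exists_pos_norm_lt
  -- On the support `|x i| < R`, so the factor lies in `[0, 1]`, and is below `1` off the null
  -- hyperplane `x i = 0`. Dominated convergence sends the integrals to `0`.
  have hlim : Tendsto (fun n : ℕ => ∫ x : E m, ((1 - R⁻¹ ^ 2 * x i ^ 2) ^ n) • φ x) atTop
      (𝓝 (∫ _ : E m, (0 : 𝕜))) := by
    have hc : Continuous φ := (hφ 0).1.continuous
    have hbd : ∀ x : E m, φ x ≠ 0 → 0 ≤ 1 - R⁻¹ ^ 2 * x i ^ 2 := fun x hx => by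
      have h1 : |x i| < R := (PiLp.norm_apply_le x i).trans_lt (hR x (subset_tsupport φ hx))
      have h2 : x i ^ 2 ≤ R ^ 2 := sq_le_sq' (by linarith [neg_abs_le (x i)])
        ((le_abs_self _).trans h1.le)
      rw [inv_pow, sub_nonneg, inv_mul_le_iff₀ (by positivity)]
      linarith
    refine tendsto_integral_of_dominated_convergence (fun x => ‖φ x‖) (fun n => ?_)
      (hc.integrable_of_hasCompactSupport (hφ 0).2.1).norm (fun n => ?_) ?_
    · exact Continuous.aestronglyMeasurable (by fun_prop)
    · refine Eventually.of_forall fun x => ?_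
      by_cases hx : φ x = 0
      · simp [hx]
      rw [norm_smul, Real.norm_of_nonneg (pow_nonneg (hbd x hx) n)]
      refine mul_le_of_le_one_left (norm_nonneg _) (pow_le_one₀ (hbd x hx) ?_)
      have : 0 ≤ R⁻¹ ^ 2 * x i ^ 2 := by positivity
      linarith
    · have h0 : ∀ᵐ x : E m, x i ≠ 0 := by
        rw [ae_iff]
        simpa using volume_coordinate_zero i
      filter_upwards [h0] with x hxi
      by_cases hx : φ x = 0
      · simp [hx]
      rw [← zero_smul ℝ (φ x)]
      refine (tendsto_pow_atTop_nhds_zero_of_lt_one (hbd x hx) ?_).smul_const _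
      have : 0 < R⁻¹ ^ 2 * x i ^ 2 := by positivity
      linarith
  -- Yet the polynomial `(1 - X²/R²)^n` equals `1` at the origin, so vanishing moments force every
  -- integral to be `1`.
  have hone : ∀ n : ℕ, ∫ x : E m, ((1 - R⁻¹ ^ 2 * x i ^ 2) ^ n) • φ x = 1 := fun n => by
    have h := integral_eval_smul hφ i
      ((1 - Polynomial.C (R⁻¹ ^ 2) * Polynomial.X ^ 2) ^ n)
    simpa using h
  simp only [hone, integral_zero] at hlim
  exact one_ne_zero (tendsto_nhds_unique tendsto_const_nhds hlim)

/-- A support of diameter zero has at most one point, which is a Lebesgue null set in positive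
dimension; this contradicts `∫ φ = 1`. -/
theorem supportDiam_pos (i : Fin m) (φ : A0 m 𝕜) : 0 < supportDiam φ := by
  refine (supportDiam_nonneg φ).lt_of_ne' fun h => ?_
  have : Nontrivial (E m) := ⟨EuclideanSpace.single i 1, 0, fun h => by
    simpa using congrArg (fun x : E m => x i) h⟩
  have hs : (tsupport (φ : E m → 𝕜)).Subsingleton := by
    intro x hx y hy
    have := Metric.dist_le_diam_of_mem φ.2.2.1.isCompact.isBounded hx hy
    exact dist_le_zero.1 (this.trans h.le)
  have hz : (φ : E m → 𝕜) =ᵐ[volume] 0 := by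
    rw [Filter.EventuallyEq, ae_iff]
    exact measure_mono_null (fun x hx => subset_tsupport _ hx) (hs.measure_zero volume)
  have h1 := φ.2.2.2.1
  rw [integral_congr_ae hz] at h1
  simp at h1

/-- Dilation by `ε⁻¹` undoes dilation by `ε`. The equivalence makes any index defined through moment
conditions constant along `φ_ε`. -/
theorem dilate_mem_iff {ε : ℝ} (hε : 0 < ε) (φ : A0 m 𝕜) (q : ℕ) :
    (dilate ε hε φ : E m → 𝕜) ∈ testSet m 𝕜 q ↔ (φ : E m → 𝕜) ∈ testSet m 𝕜 q := by
  refine ⟨fun h => ?_, dilateFun_mem hε⟩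
  have h' := dilateFun_mem (inv_pos.2 hε) h
  have e : dilateFun ε⁻¹ (dilateFun ε (φ : E m → 𝕜)) = φ := by
    funext x
    simp [dilateFun, smul_smul, hε.ne']
  rwa [show (dilate ε hε φ : E m → 𝕜) = dilateFun ε φ from rfl, e] at h'

end TestFunctions

/-! ### Generalized inequalities and asymptotic bounds -/

section Bounds

variable {m : ℕ} {𝕜 : Type*} [RCLike 𝕜]

theorem BoundedBy.congr_dilate {x y : A0 m 𝕜 → ℝ} {φ : A0 m 𝕜} {s : ℝ} (h : BoundedBy x φ s)
    (hxy : ∀ (ε : ℝ) (hε : 0 < ε), y (dilate ε hε φ) = x (dilate ε hε φ)) :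
    BoundedBy y φ s := by
  obtain ⟨c, hc, η, h0, h1, h2⟩ := h
  exact ⟨c, hc, η, h0, h1, fun ε hε hlt => by rw [hxy]; exact h2 ε hε hlt⟩

theorem boundedBy_supportDiam_rpow (φ : A0 m 𝕜) (r : ℝ) :
    BoundedBy (fun ψ : A0 m 𝕜 => supportDiam ψ ^ r) φ r := by
  have h := Real.rpow_nonneg (supportDiam_nonneg φ) r
  refine ⟨supportDiam φ ^ r + 1, by positivity, 1, one_pos, le_rfl, fun ε hε _ => ?_⟩
  have h' := Real.rpow_nonneg hε.le r
  beta_reduce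
  rw [supportDiam_dilate, Real.mul_rpow hε.le (supportDiam_nonneg φ),
    abs_of_nonneg (by positivity)]
  nlinarith

/-- Up to a null function, `i(φ)^r` equals `x` plus a nonnegative function, so `x` is at most
`i(φ)^r` plus the null error. Both are `O(ε^r)` once enough moments vanish. -/
theorem exists_boundedBy_of_le_alpha {x : A0 m 𝕜 → ℝ} (hx : IsModerate x) (hx0 : ∀ φ, 0 ≤ x φ)
    {r : ℝ} (h : GenReal.mk x hx ≤ alpha m 𝕜 r) :
    ∃ M : ℕ, ∀ φ : A0 m 𝕜, (φ : E m → 𝕜) ∈ testSet m 𝕜 M → BoundedBy x φ r := by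
  obtain ⟨w, hw, h1, h2⟩ := h
  have hr := isModerate_supportDiam_rpow (m := m) (𝕜 := 𝕜) r
  have hadd : GenReal.mk (w + x) (hw.add hx) = GenReal.mk _ hr := by
    rw [← GenReal.mk_add_mk hw hx, h1]
    exact sub_add_cancel _ _
  rw [GenReal.mk_eq_mk] at hadd
  obtain ⟨N, γ, hγ, hN⟩ := hadd
  -- With `γ q ≥ r + N` the null estimate at level `q` has exponent at least `r`.
  obtain ⟨q, hq, hNq⟩ := ((tendsto_atTop.1 hγ.2.2 (r + N)).and (eventually_ge_atTop N)).exists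
  refine ⟨q, fun φ hφ => ?_⟩
  have hb : BoundedBy (fun ψ => |w ψ + x ψ - supportDiam ψ ^ r|) φ r :=
    (hN q hNq φ hφ).mono (fun ψ => (abs_abs _).le) (by linarith)
  refine ((boundedBy_supportDiam_rpow φ r).add hb).mono (fun ψ => ?_) le_rfl
  rw [abs_of_nonneg (hx0 ψ)]
  refine le_trans ?_ (le_abs_self _)
  simp only [Pi.add_apply]
  linarith [le_abs_self (w ψ + x ψ - supportDiam ψ ^ r), h2 ψ]

/-- A partial converse with a loss of exponent: the order compares with `i(φ_ε)^r = ε^r i(φ)^r`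
exactly, without a free constant. The spare factor `ε^(s-r)` absorbs the constant `c`, which needs
`i(φ) > 0` and hence positive dimension. -/
theorem mk_le_alpha (i : Fin m) {x : A0 m 𝕜 → ℝ} (hx : IsModerate x) {r s : ℝ} (hrs : r < s)
    (M : ℕ) (h : ∀ φ : A0 m 𝕜, (φ : E m → 𝕜) ∈ testSet m 𝕜 M → BoundedBy x φ s) :
    GenReal.mk x hx ≤ alpha m 𝕜 r := by
  refine GenReal.mk_le_mk _ _ M fun φ hφ => ?_
  obtain ⟨c, hc, η, h0, h1, h2⟩ := h φ hφ
  have hd := supportDiam_pos i φ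
  have hdr := Real.rpow_pos_of_pos hd r
  have hlim : Tendsto (fun ε : ℝ => c * ε ^ (s - r)) (𝓝[>] 0) (𝓝 0) := by
    have h3 : ContinuousAt (fun ε : ℝ => c * ε ^ (s - r)) 0 :=
      continuousAt_const.mul (Real.continuousAt_rpow_const _ _ (Or.inr (by linarith)))
    have h4 := h3.tendsto
    simp only [Real.zero_rpow (sub_pos.2 hrs).ne', mul_zero] at h4
    exact h4.mono_left nhdsWithin_le_nhds
  have hev := hlim.eventually_lt_const hdr
  rw [eventually_nhdsWithin_iff, Metric.eventually_nhds_iff] at hev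
  obtain ⟨δ, hδ, hev⟩ := hev
  refine ⟨min η δ, lt_min h0 hδ, fun ε hε hlt => ?_⟩
  have h5 := h2 ε hε (hlt.trans_le (min_le_left _ _))
  have h6 := hev (y := ε) (by simpa [abs_of_pos hε] using hlt.trans_le (min_le_right _ _)) hε
  rw [supportDiam_dilate, Real.mul_rpow hε.le hd.le]
  calc x (dilate ε hε φ) ≤ c * ε ^ s := (le_abs_self _).trans h5
    _ = ε ^ r * (c * ε ^ (s - r)) := by
      rw [mul_left_comm, ← Real.rpow_add hε, add_sub_cancel]
    _ ≤ ε ^ r * supportDiam φ ^ r := by gcongr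

end Bounds

/-! ### Construction of the limit net -/

section Completeness

variable {m : ℕ} {𝕜 : Type*} [RCLike 𝕜] {ω : BoundedOpen m}

/-- Representatives of an element of `W_{σ,r}` have derivatives of size `O(ε^r)`, uniformly on
some `A_M`. -/
theorem exists_boundedBy_of_mem_W {σ : MultiIndex m} {r : ℝ} (v : moderateNets 𝕜 ω)
    (h : ColombeauAlgebra.mk v ∈ W 𝕜 ω σ r) :
    ∃ M : ℕ, ∀ κ ≤ σ, ∀ φ : A0 m 𝕜, (φ : E m → 𝕜) ∈ testSet m 𝕜 M →
      BoundedBy (supNorm κ v.1) φ r := by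
  have h' : ∀ κ : Set.Iic σ, ∃ M : ℕ, ∀ φ : A0 m 𝕜, (φ : E m → 𝕜) ∈ testSet m 𝕜 M →
      BoundedBy (supNorm κ.1 v.1) φ r := fun κ =>
    exists_boundedBy_of_le_alpha (v.2 κ.1) (supNorm_nonneg _ _) (h κ.1 κ.2)
  choose M hM using h'
  obtain ⟨B, hB⟩ := (Set.finite_range M).bddAbove
  exact ⟨B, fun κ hκ φ hφ => hM ⟨κ, hκ⟩ φ (testSet_anti (hB ⟨⟨κ, hκ⟩, rfl⟩) hφ)⟩

/-- The sum has `d - k` terms, and the lowest exponent `k + 1` dominates. The constants add up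
without any uniformity in `j` because `φ` and `d` are fixed. -/
theorem boundedBy_telescope {κ : MultiIndex m} {u : ℕ → A0 m 𝕜 → Smooth 𝕜 ω} {φ : A0 m 𝕜}
    {k d : ℕ} (hkd : k ≤ d)
    (h : ∀ j, k ≤ j → j < d → BoundedBy (supNorm κ (u (j + 1) - u j)) φ (j + 1)) :
    BoundedBy (supNorm κ (u d - u k)) φ (k + 1) := by
  induction d, hkd using Nat.le_induction with
  | base => exact ⟨1, one_pos, 1, one_pos, le_rfl, fun ε hε _ => by
      have := Real.rpow_nonneg hε.le (k + 1 : ℝ)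
      simpa [supNorm] using this⟩
  | succ d hkd ih =>
    have h1 := ih fun j hkj hj => h j hkj (hj.trans d.lt_succ_self)
    have h2 := (h d hkd d.lt_succ_self).mono (t := k + 1) (fun _ => le_rfl)
      (by gcongr)
    refine (h2.add h1).mono (fun ψ => ?_) le_rfl
    rw [abs_of_nonneg (supNorm_nonneg _ _ _)]
    refine le_trans ?_ (le_abs_self _)
    have h3 := supNorm_add_le κ (u (d + 1) - u d) (u d - u k) ψ
    rwa [sub_add_sub_cancel] at h3

/-- A rapidly Cauchy sequence of moderate nets has a limit net in positive dimension: select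
along each test function the term indexed by the order of its vanishing moments. -/
theorem exists_limit_net (i : Fin m) (u : ℕ → moderateNets 𝕜 ω)
    (hu : ∀ n : ℕ, ColombeauAlgebra.mk (u (n + 1) - u n) ∈ W 𝕜 ω (fun _ => n) (n + 1)) :
    ∃ v : moderateNets 𝕜 ω, ∀ (k : ℕ) (κ : MultiIndex m), (κ ≤ fun _ => k) →
      ∃ P : ℕ, ∀ φ : A0 m 𝕜, (φ : E m → 𝕜) ∈ testSet m 𝕜 P →
        BoundedBy (supNorm κ (v - u k : moderateNets 𝕜 ω).1) φ (k + 1) := by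
  classical
  choose M hM using fun n => exists_boundedBy_of_mem_W (u (n + 1) - u n) (hu n)
  -- The `n` inside the maximum guarantees that the search stops, even if the `M n` stay bounded; `M
  -- n` makes the `n`-th estimate available below the stopping index.
  have hex : ∀ φ : A0 m 𝕜, ∃ n, (φ : E m → 𝕜) ∉ testSet m 𝕜 (max n (M n)) := fun φ => by
    obtain ⟨q, hq⟩ := exists_notMem_testSet i (φ : E m → 𝕜)
    exact ⟨q, fun h => hq (testSet_anti (le_max_left _ _) h)⟩
  let d : A0 m 𝕜 → ℕ := fun φ => Nat.find (hex φ)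
  have hd_dilate : ∀ (ε : ℝ) (hε : 0 < ε) (φ : A0 m 𝕜), d (dilate ε hε φ) = d φ :=
    fun ε hε φ => Nat.find_congr' fun {n} => not_congr (dilate_mem_iff hε φ _)
  have hd_mem : ∀ (φ : A0 m 𝕜) (j : ℕ), j < d φ → (φ : E m → 𝕜) ∈ testSet m 𝕜 (M j) :=
    fun φ j hj => testSet_anti (le_max_right _ _) (not_not.1 (Nat.find_min (hex φ) hj))
  have hd_ge : ∀ k : ℕ, ∃ P : ℕ, ∀ φ : A0 m 𝕜, (φ : E m → 𝕜) ∈ testSet m 𝕜 P → k ≤ d φ := by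
    intro k
    -- The sum is merely a common upper bound of the thresholds for `j < k`, so no such `j` can be
    -- the stopping index on this `A_P`.
    refine ⟨∑ j ∈ Finset.range k, max j (M j), fun φ hφ => ?_⟩
    by_contra! hlt
    refine Nat.find_spec (hex φ) (testSet_anti ?_ hφ)
    exact Finset.single_le_sum (f := fun j => max j (M j)) (fun _ _ => Nat.zero_le _)
      (Finset.mem_range.2 hlt)
  let v : A0 m 𝕜 → Smooth 𝕜 ω := fun φ => (u (d φ)).1 φ
  have key : ∀ (k : ℕ) (κ : MultiIndex m), (κ ≤ fun _ => k) → ∃ P : ℕ, ∀ φ : A0 m 𝕜,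
      (φ : E m → 𝕜) ∈ testSet m 𝕜 P → BoundedBy (supNorm κ (v - (u k).1)) φ (k + 1) := by
    intro k κ hκ
    obtain ⟨P, hP⟩ := hd_ge k
    refine ⟨P, fun φ hφ => ?_⟩
    have h := boundedBy_telescope (κ := κ) (u := fun n => (u n).1) (φ := φ) (hP φ hφ)
      fun j hkj hj => hM j κ (hκ.trans fun _ => hkj) φ (hd_mem φ j hj)
    -- The telescope treats the fixed index `d φ`; on every dilate of `φ` the net `v` uses this same
    -- index.
    refine h.congr_dilate fun ε hε => ?_
    simp only [supNorm, Pi.sub_apply, v, hd_dilate]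
  refine ⟨⟨v, fun κ => ?_⟩, key⟩
  obtain ⟨k, hk⟩ : ∃ k, κ ≤ fun _ => k :=
    ⟨∑ i, κ i, fun i => Finset.single_le_sum (fun _ _ => Nat.zero_le _) (Finset.mem_univ i)⟩
  obtain ⟨P, hP⟩ := key k κ hk
  -- The bound `O(ε^(k+1))` is far better than `O(ε^(-P))`; moderateness of `v` then follows from `v
  -- = (v - u k) + u k`.
  have h1 : IsModerate (supNorm κ (v - (u k).1)) := ⟨P, fun φ hφ =>
    (hP φ hφ).mono (fun _ => le_rfl) (by
      have : (0 : ℝ) ≤ P := P.cast_nonneg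
      have : (0 : ℝ) ≤ k := k.cast_nonneg
      linarith)⟩
  refine (h1.add ((u k).2 κ)).mono fun φ => ?_
  rw [abs_of_nonneg (supNorm_nonneg _ _ _)]
  refine le_trans ?_ (le_abs_self _)
  have h2 := supNorm_add_le κ (v - (u k).1) (u k).1 φ
  rwa [sub_add_cancel] at h2

end Completeness

/-! ### Reduction to sequences and conclusion -/

section Topology

variable {m : ℕ} {𝕜 : Type*} [RCLike 𝕜]

/-- Supports in a one-point space have diameter `0`, and `0^r = 0` for `r > 0`; moreover there is
only one multi-index. -/
theorem W_eq_of_dim_zero (ω : BoundedOpen 0) (σ τ : MultiIndex 0) {r s : ℝ} (hr : 0 < r)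
    (hs : 0 < s) : W 𝕜 ω σ r = W 𝕜 ω τ s := by
  have h0 : ∀ φ : A0 0 𝕜, supportDiam φ = 0 := fun φ =>
    Metric.diam_subsingleton Set.subsingleton_of_subsingleton
  have ha : alpha 0 𝕜 r = alpha 0 𝕜 s := by
    unfold alpha
    congr 1
    funext φ
    rw [h0, Real.zero_rpow hr.ne', Real.zero_rpow hs.ne']
  rw [Subsingleton.elim σ τ]
  simp only [W, ha]

theorem hasBasis_nhds_zero (ω : BoundedOpen m) :
    (𝓝 (0 : ColombeauAlgebra 𝕜 ω)).HasBasis (fun p : MultiIndex m × ℕ => 1 ≤ p.2)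
      fun p => W 𝕜 ω p.1 p.2 := by
  refine (AddGroupFilterBasis.nhds_zero_hasBasis (basisW 𝕜 ω)).to_hasBasis ?_ ?_
  · rintro _ ⟨σ, r, hr, rfl⟩
    exact ⟨(σ, r), hr, subset_rfl⟩
  · rintro ⟨σ, r⟩ hr
    exact ⟨_, ⟨σ, r, hr, rfl⟩, subset_rfl⟩

theorem uniformity_eq_comap (ω : BoundedOpen m) : uniformity (ColombeauAlgebra 𝕜 ω) =
    comap (fun p => p.2 - p.1) (𝓝 (0 : ColombeauAlgebra 𝕜 ω)) := by
  simp only [sub_eq_add_neg]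
  rfl

instance (ω : BoundedOpen m) : (uniformity (ColombeauAlgebra 𝕜 ω)).IsCountablyGenerated := by
  have : (𝓝 (0 : ColombeauAlgebra 𝕜 ω)).IsCountablyGenerated :=
    Filter.HasCountableBasis.isCountablyGenerated
      ⟨hasBasis_nhds_zero ω, Set.to_countable _⟩
  rw [uniformity_eq_comap]
  infer_instance

theorem tendsto_of_forall_W {f : ℕ → ColombeauAlgebra 𝕜 ω} {g : ColombeauAlgebra 𝕜 ω}
    (h : ∀ (σ : MultiIndex m) (r : ℕ), 1 ≤ r → ∀ᶠ n in atTop, f n - g ∈ W 𝕜 ω σ r) :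
    Tendsto f atTop (𝓝 g) := by
  rw [← tendsto_sub_nhds_zero_iff]
  exact (hasBasis_nhds_zero ω).tendsto_right_iff.2 fun p hp => h p.1 p.2 hp

instance (ω : BoundedOpen m) : CompleteSpace (ColombeauAlgebra 𝕜 ω) := by
  refine UniformSpace.complete_of_convergent_controlled_sequences
    -- The exponent is `N + 1` because the basis admits only `r ≥ 1`, and because a limit estimate
    -- of order `ε^(N+1)` leaves room above exponent `N`.
    (fun N => {p | p.2 - p.1 ∈ W 𝕜 ω (fun _ => N) ((N + 1 : ℕ) : ℝ)}) (fun N => ?_) ?_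
  · rw [uniformity_eq_comap]
    exact preimage_mem_comap ((hasBasis_nhds_zero ω).mem_of_mem
      (i := (fun _ => N, N + 1)) (Nat.le_add_left 1 N))
  intro f hf
  rcases m with _ | m
  · refine ⟨f 0, tendsto_of_forall_W fun σ r hr => Eventually.of_forall fun n => ?_⟩
    rw [W_eq_of_dim_zero ω σ (fun _ => 0) (s := ((0 + 1 : ℕ) : ℝ)) (by positivity) (by simp)]
    exact hf 0 0 n le_rfl (Nat.zero_le n)
  · choose u hu using fun n => (f n).exists_rep
    have hstep : ∀ n : ℕ,
        ColombeauAlgebra.mk (u (n + 1) - u n) ∈ W 𝕜 ω (fun _ => n) (n + 1) := fun n => by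
      have h := hf n n (n + 1) le_rfl n.le_succ
      rw [← hu n, ← hu (n + 1), Nat.cast_add_one] at h
      exact h
    obtain ⟨v, hv⟩ := exists_limit_net 0 u hstep
    refine ⟨ColombeauAlgebra.mk v, tendsto_of_forall_W fun σ r hr => ?_⟩
    -- The sum bounds every entry of `σ`, so `n` covers all `κ ≤ σ`; and `r ≤ n < n + 1` gives the
    -- strict inequality that `mk_le_alpha` needs.
    filter_upwards [eventually_ge_atTop (max r (∑ i, σ i))] with n hn κ hκ
    have hκn : κ ≤ fun _ => n := fun i => (hκ i).trans <|
      (Finset.single_le_sum (fun _ _ => Nat.zero_le _) (Finset.mem_univ i)).trans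
        ((le_max_right _ _).trans hn)
    obtain ⟨P, hP⟩ := hv n κ hκn
    rw [← genSeminorm_neg, neg_sub, ← hu n]
    refine mk_le_alpha 0 ((v - u n).2 κ) (s := n + 1) ?_ P hP
    have : (r : ℝ) ≤ n := by exact_mod_cast (le_max_left _ _).trans hn
    linarith

end Topology

end FullColombeau

theorem theorem1p12 {𝕜 : Type*} [RCLike 𝕜] {m : ℕ} (ω : Set (EuclideanSpace ℝ (Fin m)))
    (hopen : IsOpen ω) (hbdd : Bornology.IsBounded ω) :
    CompleteSpace (FullColombeau.ColombeauAlgebra 𝕜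
      (FullColombeau.BoundedOpen.mk ω hopen hbdd)) :=
  inferInstance
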